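/- Let $(\Omega,\mathcal F,\mathbb P)$ be a probability space and let $(\tau_x)_{x\in\mathbb R^N}$ be an ergodic $N$-dimensional dynamical system on it: $\tau_0=\mathrm{id}$ and $\tau_{x+y}=\tau_x\circ\tau_y$ for all $x,y\in\mathbb R^N$; the map $(x,\omega)\mapsto\tau_x\omega$ is jointly measurable; each $\tau_x:\Omega\to\Omega$ preserves $\mathbb P$; and every $A\in\mathcal F$ with $\mathbb P(\tau_xA\,\Delta\,A)=0$ for all $x\in\mathbb R^N$ has probability $0$ or $1$. A *Lipschitz random function* is a map $\omega\mapsto v(\cdot,\omega)$ from $\Omega$ to $C(\mathbb R^N)$ that is measurable with respect to the Borel $\sigma$-algebra of the topology of uniform convergence on compact sets and for which there is a constant $\kappa$, independent of $\omega$, such that $v(\cdot,\omega)$ is $\kappa$-Lipschitz for every $\omega\in\Omega$. It is *stationary* if for every $z\in\mathbb R^N$, almost surely in $\omega$, $v(x+z,\omega)=v(x,\tau_z\omega)$ for all $x\in\mathbb R^N$. It has *stationary increments* if for every $z\in\mathbb R^N$, almost surely in $\omega$, $v(x+z,\omega)-v(y+z,\omega)=v(x,\tau_z\omega)-v(y,\tau_z\omega)$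 for all $x,y\in\mathbb R^N$. Its *gradient has mean zero* if for every $x\in\mathbb R^N$ the function $v(\cdot,\omega)$ is differentiable at $x$ almost surely in $\omega$, and the ($\mathbb P$-a.s. defined) random vector $Dv(x,\cdot)$ is integrable with $\mathbb E(Dv(x,\cdot))=0$. A Lipschitz random function is *admissible* if it has stationary increments and gradient with mean zero. **Theorem.** Every stationary Lipschitz random function is admissible. -/

import Mathlib

open MeasureTheory
open scoped NNReal

/-- `v` is a Lipschitz random function on `ℝ^N`: a random variable with values in the space
`Lip_κ(ℝ^N)` of `κ`-Lipschitz real functions for some deterministic `κ`, where `C(ℝ^N, ℝ)` (and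
its subset `Lip_κ(ℝ^N)`) carries the topology of uniform convergence on compact sets, which is
the topology Mathlib puts on `C(_, _)`, and the corresponding Borel `σ`-algebra. -/
structure IsLipschitzRandomFunction {N : ℕ} {Ω : Type*} [MeasurableSpace Ω]
    (v : Ω → C(EuclideanSpace ℝ (Fin N), ℝ)) : Prop where
  measurable : Measurable[_, borel C(EuclideanSpace ℝ (Fin N), ℝ)] v
  lipschitz : ∃ κ : ℝ≥0, ∀ ω, LipschitzWith κ (v ω)

/-- `v(· + z, ω) = v(·, τ_z ω)` on `ℝ^N` for almost every `ω`, for every `z`;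
here `τ_z ω` is written `z +ᵥ ω`. -/
def IsStationaryRandomFunction {N : ℕ} {Ω : Type*} [MeasurableSpace Ω]
    [AddAction (EuclideanSpace ℝ (Fin N)) Ω] (P : Measure Ω)
    (v : Ω → C(EuclideanSpace ℝ (Fin N), ℝ)) : Prop :=
  ∀ z : EuclideanSpace ℝ (Fin N), ∀ᵐ ω ∂P, ∀ x : EuclideanSpace ℝ (Fin N),
    v ω (x + z) = v (z +ᵥ ω) x

/-- `v(x + z, ω) - v(y + z, ω) = v(x, τ_z ω) - v(y, τ_z ω)` for all `x`, `y`,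
for almost every `ω`, for every `z`. -/
def HasStationaryIncrements {N : ℕ} {Ω : Type*} [MeasurableSpace Ω]
    [AddAction (EuclideanSpace ℝ (Fin N)) Ω] (P : Measure Ω)
    (v : Ω → C(EuclideanSpace ℝ (Fin N), ℝ)) : Prop :=
  ∀ z : EuclideanSpace ℝ (Fin N), ∀ᵐ ω ∂P, ∀ x y : EuclideanSpace ℝ (Fin N),
    v ω (x + z) - v ω (y + z) = v (z +ᵥ ω) x - v (z +ᵥ ω) y

/-- The gradient of `v` has mean `0`: for every point `x`, the random variable `Dv(x, ·)` is almost
surely defined (`v(·, ω)` is differentiable at `x` for almost every `ω`), it is integrable, and its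
expectation vanishes. -/
def HasGradientMeanZero {N : ℕ} {Ω : Type*} [MeasurableSpace Ω] (P : Measure Ω)
    (v : Ω → C(EuclideanSpace ℝ (Fin N), ℝ)) : Prop :=
  ∀ x : EuclideanSpace ℝ (Fin N),
    (∀ᵐ ω ∂P, DifferentiableAt ℝ (v ω) x) ∧
    Integrable (fun ω => gradient (v ω) x) P ∧
    ∫ ω, gradient (v ω) x ∂P = 0

/-- Admissible random functions: Lipschitz random functions with stationary increments and
gradient with mean `0`. -/
structure IsAdmissible {N : ℕ} {Ω : Type*} [MeasurableSpace Ω]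
    [AddAction (EuclideanSpace ℝ (Fin N)) Ω] (P : Measure Ω)
    (v : Ω → C(EuclideanSpace ℝ (Fin N), ℝ)) : Prop where
  isLipschitzRandomFunction : IsLipschitzRandomFunction v
  hasStationaryIncrements : HasStationaryIncrements P v
  hasGradientMeanZero : HasGradientMeanZero P v

/-! Stationarity turns the increment `v ω (x + z) - v ω x` into a coboundary of the
measure-preserving shift by `z`, bounded by `κ * ‖z‖`. Its mean vanishes by
`integral_comp_sub_eq_zero`, although `v · x` itself may fail to be integrable. Difference quotients
thus have mean zero, are bounded, and converge to directional derivatives wherever `v ω` is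
differentiable. Rademacher and Fubini give one point of almost sure differentiability, and
stationarity carries it to every point. -/

/-- If `T` preserves a finite measure and the coboundary `f ∘ T - f` is bounded, its integral
vanishes, even when `f` itself is not integrable. -/
theorem integral_comp_sub_eq_zero {Ω : Type*} [MeasurableSpace Ω] {P : Measure Ω}
    [IsFiniteMeasure P] {T : Ω → Ω} (hT : MeasurePreserving T P P) {f : Ω → ℝ}
    (hf : Measurable f) {C : ℝ} (hC : ∀ᵐ ω ∂P, |f (T ω) - f ω| ≤ C) :
    ∫ ω, (f (T ω) - f ω) ∂P = 0 := by
  -- Truncation at height `n` makes `f` integrable and, being 1-Lipschitz, keeps the bound `C` on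
  -- the coboundary; dominated convergence then applies.
  let φ : ℕ → ℝ → ℝ := fun n s => max (-(n : ℝ)) (min n s)
  have hφm : ∀ n, Measurable (φ n) := fun n => by unfold φ; fun_prop
  have hφb : ∀ n s, ‖φ n s‖ ≤ n := fun n s => by
    rw [Real.norm_eq_abs, abs_le]
    exact ⟨le_max_left _ _, max_le (by linarith [n.cast_nonneg (α := ℝ)]) (min_le_left _ _)⟩
  have hφl : ∀ n s t, |φ n s - φ n t| ≤ |s - t| := fun n s t =>
    (abs_max_sub_max_le_max _ _ _ _).trans <| max_le (by simp) <|
      (abs_min_sub_min_le_max _ _ _ _).trans <| max_le (by simp) le_rfl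
  have hφt : ∀ s, Filter.Tendsto (fun n => φ n s) Filter.atTop (nhds s) := fun s => by
    obtain ⟨m, hm⟩ := exists_nat_ge |s|
    refine tendsto_const_nhds.congr' ?_
    filter_upwards [Filter.eventually_ge_atTop m] with n hn
    have h : |s| ≤ n := hm.trans (by exact_mod_cast hn)
    rw [abs_le] at h
    simp only [φ]
    rw [min_eq_right h.2, max_eq_right h.1]
  have hφi : ∀ n, Integrable (fun ω => φ n (f ω)) P := fun n =>
    Integrable.of_bound ((hφm n).comp hf).aestronglyMeasurable n (.of_forall fun _ => hφb _ _)
  have hzero : ∀ n, ∫ ω, (φ n (f (T ω)) - φ n (f ω)) ∂P = 0 := fun n => by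
    have hi : Integrable (fun ω => φ n (f (T ω))) P := hT.integrable_comp_of_integrable (hφi n)
    have he : ∫ ω, φ n (f (T ω)) ∂P = ∫ ω, φ n (f ω) ∂P := by
      have hmap := integral_map (f := fun ω => φ n (f ω)) hT.aemeasurable
        ((hφm n).comp hf).aestronglyMeasurable
      rw [← hmap, hT.map_eq]
    rw [integral_sub hi (hφi n), he, sub_self]
  have hlim : Filter.Tendsto (fun n => ∫ ω, (φ n (f (T ω)) - φ n (f ω)) ∂P) Filter.atTop
      (nhds (∫ ω, (f (T ω) - f ω) ∂P)) := by
    refine tendsto_integral_of_dominated_convergence (fun _ => C) (fun n => ?_)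
      (integrable_const C) (fun n => ?_) (.of_forall fun ω => (hφt _).sub (hφt _))
    · exact (((hφm n).comp (hf.comp hT.measurable)).sub
        ((hφm n).comp hf)).aestronglyMeasurable
    · filter_upwards [hC] with ω hω using (hφl _ _ _).trans hω
  simp only [hzero] at hlim
  exact tendsto_nhds_unique hlim tendsto_const_nhds

section

variable {N : ℕ} {Ω : Type*} [MeasurableSpace Ω]
  {v : Ω → C(EuclideanSpace ℝ (Fin N), ℝ)}

theorem IsLipschitzRandomFunction.measurable_apply (hv : IsLipschitzRandomFunction v)
    (x : EuclideanSpace ℝ (Fin N)) : Measurable fun ω => v ω x := by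
  borelize C(EuclideanSpace ℝ (Fin N), ℝ)
  exact (continuous_eval_const x).measurable.comp hv.measurable

/-- Joint measurability is what Fubini needs; it comes from the joint continuity of evaluation `(u,
x) ↦ u x`. -/
theorem IsLipschitzRandomFunction.measurableSet_differentiableAt
    (hv : IsLipschitzRandomFunction v) :
    MeasurableSet {p : Ω × EuclideanSpace ℝ (Fin N) | DifferentiableAt ℝ (v p.1) p.2} := by
  borelize C(EuclideanSpace ℝ (Fin N), ℝ)
  have hm : Measurable v := hv.measurable
  have h := measurableSet_of_differentiableAt_with_param ℝ
    (f := fun (u : C(EuclideanSpace ℝ (Fin N), ℝ)) x => u x)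
    (by unfold Function.uncurry; fun_prop)
  exact h.preimage (hm.prodMap measurable_id)

theorem IsLipschitzRandomFunction.measurable_gradient (hv : IsLipschitzRandomFunction v)
    (x : EuclideanSpace ℝ (Fin N)) : Measurable fun ω => gradient (v ω) x := by
  borelize C(EuclideanSpace ℝ (Fin N), ℝ)
  have hm : Measurable v := hv.measurable
  have h := measurable_fderiv_with_param ℝ
    (f := fun (u : C(EuclideanSpace ℝ (Fin N), ℝ)) x => u x)
    (by unfold Function.uncurry; fun_prop)
  exact (InnerProductSpace.toDual ℝ (EuclideanSpace ℝ (Fin N))).symm.continuous.measurable.comp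
    (h.comp (hm.prodMk measurable_const))

theorem IsLipschitzRandomFunction.integrable_gradient {P : Measure Ω} [IsFiniteMeasure P]
    (hv : IsLipschitzRandomFunction v) (x : EuclideanSpace ℝ (Fin N)) :
    Integrable (fun ω => gradient (v ω) x) P := by
  obtain ⟨κ, hκ⟩ := hv.lipschitz
  refine Integrable.of_bound (hv.measurable_gradient x).aestronglyMeasurable κ
    (.of_forall fun ω => ?_)
  rw [gradient, LinearIsometryEquiv.norm_map]
  -- The bound also covers points of non-differentiability, where `fderiv` is `0`.
  exact norm_fderiv_le_of_lipschitz ℝ (hκ ω)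

/-- By Rademacher's theorem and Fubini's theorem, a Lipschitz random function is almost surely
differentiable at almost every fixed point. -/
theorem IsLipschitzRandomFunction.ae_ae_differentiableAt {P : Measure Ω} [SFinite P]
    (hv : IsLipschitzRandomFunction v) :
    ∀ᵐ x : EuclideanSpace ℝ (Fin N), ∀ᵐ ω ∂P, DifferentiableAt ℝ (v ω) x := by
  obtain ⟨κ, hκ⟩ := hv.lipschitz
  rw [← Measure.ae_ae_comm hv.measurableSet_differentiableAt]
  exact .of_forall fun ω => (hκ ω).ae_differentiableAt

variable {P : Measure Ω} [AddAction (EuclideanSpace ℝ (Fin N)) Ω]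

theorem IsStationaryRandomFunction.hasStationaryIncrements
    (hstat : IsStationaryRandomFunction P v) : HasStationaryIncrements P v := fun z => by
  filter_upwards [hstat z] with ω hω x y
  rw [hω, hω]

variable [MeasurableVAdd₂ (EuclideanSpace ℝ (Fin N)) Ω]
  [VAddInvariantMeasure (EuclideanSpace ℝ (Fin N)) Ω P]

theorem IsStationaryRandomFunction.ae_differentiableAt [SFinite P]
    (hstat : IsStationaryRandomFunction P v) (hv : IsLipschitzRandomFunction v)
    (x : EuclideanSpace ℝ (Fin N)) : ∀ᵐ ω ∂P, DifferentiableAt ℝ (v ω) x := by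
  obtain ⟨y, hy⟩ := (hv.ae_ae_differentiableAt (P := P)).exists
  filter_upwards [hstat (x - y),
    (measurePreserving_vadd (x - y) P).quasiMeasurePreserving.ae hy] with ω hω hd
  -- Near `x`, `v ω` is a translate of the shifted realization near the good point `y`.
  have heq : ∀ w, v ω w = v ((x - y) +ᵥ ω) (w - (x - y)) := fun w => by
    simpa using hω (w - (x - y))
  rw [show (v ω : EuclideanSpace ℝ (Fin N) → ℝ) = _ from funext heq]
  refine DifferentiableAt.comp x ?_ (by fun_prop)
  rwa [sub_sub_cancel]

theorem IsStationaryRandomFunction.integral_sub_eq_zero [IsFiniteMeasure P]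
    (hstat : IsStationaryRandomFunction P v) (hv : IsLipschitzRandomFunction v)
    (x z : EuclideanSpace ℝ (Fin N)) : ∫ ω, (v ω (x + z) - v ω x) ∂P = 0 := by
  obtain ⟨κ, hκ⟩ := hv.lipschitz
  have h := integral_comp_sub_eq_zero (measurePreserving_vadd z P) (hv.measurable_apply x)
    (C := κ * ‖z‖) (by
      filter_upwards [hstat z] with ω hω
      rw [← hω]
      simpa [Real.dist_eq, dist_eq_norm] using (hκ ω).dist_le_mul (x + z) x)
  rw [← h]
  refine integral_congr_ae ?_
  filter_upwards [hstat z] with ω hω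
  rw [hω]

/-- The expected gradient is the limit of the expectations of the difference quotients. -/
theorem IsStationaryRandomFunction.integral_gradient_eq_zero [IsFiniteMeasure P]
    (hstat : IsStationaryRandomFunction P v) (hv : IsLipschitzRandomFunction v)
    (x : EuclideanSpace ℝ (Fin N)) : ∫ ω, gradient (v ω) x ∂P = 0 := by
  obtain ⟨κ, hκ⟩ := hv.lipschitz
  -- Testing against a fixed `e` reduces the claim to scalar directional derivatives.
  refine ext_inner_left ℝ fun e => ?_
  rw [inner_zero_right, ← integral_inner (hv.integrable_gradient x)]
  have hlim : Filter.Tendsto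
      (fun n : ℕ => ∫ ω, (n : ℝ) * (v ω (x + (n : ℝ)⁻¹ • e) - v ω x) ∂P) Filter.atTop
      (nhds (∫ ω, inner ℝ e (gradient (v ω) x) ∂P)) := by
    refine tendsto_integral_of_dominated_convergence (fun _ => κ * ‖e‖) (fun n => ?_)
      (integrable_const _) (fun n => .of_forall fun ω => ?_) ?_
    · exact (((hv.measurable_apply _).sub
        (hv.measurable_apply x)).const_mul _).aestronglyMeasurable
    -- At `n = 0` the factor `n` makes the quotient zero.
    · rcases eq_or_ne (n : ℝ) 0 with hn | hn
      · simp only [hn, zero_mul, norm_zero]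
        positivity
      · have h := (hκ ω).dist_le_mul (x + (n : ℝ)⁻¹ • e) x
        rw [Real.dist_eq, dist_eq_norm, add_sub_cancel_left, norm_smul, norm_inv,
          Real.norm_natCast] at h
        rw [norm_mul, Real.norm_natCast, Real.norm_eq_abs]
        calc (n : ℝ) * _ ≤ n * (κ * ((n : ℝ)⁻¹ * ‖e‖)) := by gcongr
          _ = κ * ‖e‖ := by field_simp
    · filter_upwards [hstat.ae_differentiableAt hv x] with ω hd
      have h := hd.hasFDerivAt.lim_real e
      have hg : inner ℝ e (gradient (v ω) x) = fderiv ℝ (v ω) x e := by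
        rw [real_inner_comm, gradient, InnerProductSpace.toDual_symm_apply]
      rw [hg]
      exact h.comp tendsto_natCast_atTop_atTop
  simp only [integral_const_mul, hstat.integral_sub_eq_zero hv, mul_zero] at hlim
  exact tendsto_nhds_unique hlim tendsto_const_nhds

end

theorem mainTheorem12 {N : ℕ} {Ω : Type*} [MeasurableSpace Ω]
    (P : Measure Ω) [IsProbabilityMeasure P]
    [AddAction (EuclideanSpace ℝ (Fin N)) Ω]
    [MeasurableVAdd₂ (EuclideanSpace ℝ (Fin N)) Ω]
    [ErgodicVAdd (EuclideanSpace ℝ (Fin N)) Ω P]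
    (v : Ω → C(EuclideanSpace ℝ (Fin N), ℝ))
    (hv : IsLipschitzRandomFunction v) (hstat : IsStationaryRandomFunction P v) :
    IsAdmissible P v where
  isLipschitzRandomFunction := hv
  hasStationaryIncrements := hstat.hasStationaryIncrements
  hasGradientMeanZero x :=
    ⟨hstat.ae_differentiableAt hv x, hv.integrable_gradient x,
      hstat.integral_gradient_eq_zero hv x⟩
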